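/- Let $m,n\ge 0$ be integers. For $1\le j\le m$ let $V_j\subseteq\mathbb{R}$ be an open neighbourhood of $0$ and let $\Sigma_j:V_j\to\mathbb{R}^n$ be a smooth ($C^\infty$) parametrisation of a curve $S_j$, i.e. $\Sigma_j$ is injective and $\Sigma_j'(x)\neq 0$ for all $x\in V_j$. Let $p_1,\dots,p_m\ge 0$ be real numbers (with the convention $t^0=1$ for all $t\in[0,\infty]$) and let $L_j:=(\mathrm{d}\Sigma_j(0))^*:\mathbb{R}^n\to\mathbb{R}$, so that $L_jx=\langle x,\Sigma_j'(0)\rangle$. Let $\mathrm{BL}(\mathbf{L},\mathbf{p})\in[0,\infty]$ be the smallest constant $C$ for which $$\int_{\mathbb{R}^n}\prod_{j=1}^m f_j(L_jx)^{p_j}\,dx\le C\prod_{j=1}^m\Bigl(\int_{\mathbb{R}}f_j\Bigr)^{p_j}$$ holds for all nonnegative integrable functions $f_1,\dots,f_m$ on $\mathbb{R}$. For an open set $U_j\subseteq V_j$ and $g_j\in L^2(U_j)$ write $$E_jg_j(\xi):=\int_{U_j}e^{-2\pi i\xi\cdot\Sigma_j(x)}g_j(x)\,dx\qquad(\xi\in\mathbb{R}^n).$$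 Suppose that $\mathrm{BL}(\mathbf{L},\mathbf{p})<\infty$. Then there exist $\delta>0$ and $C<\infty$, depending only on $n$, $m$, $\mathbf{p}$ and $\Sigma_1,\dots,\Sigma_m$, such that, for all open neighbourhoods $U_j\subseteq V_j\cap(-\delta,\delta)$ of $0$ and all $g_j\in L^2(U_j)$, $1\le j\le m$, $$\int_{\mathbb{R}^n}\prod_{j=1}^m|E_jg_j(\xi)|^{2p_j}\,d\xi\le C\prod_{j=1}^m\|g_j\|_{L^2(U_j)}^{2p_j}.$$ -/

import Mathlib

open MeasureTheory Set
open scoped ENNReal NNReal ContDiff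

noncomputable section

/-- `γ` is a smooth parametrisation, by the open neighbourhood `V` of the origin of `F`, of a
submanifold of `E` of dimension `dim F`: a smooth injective immersion. -/
structure IsSmoothParametrisation {F E : Type*}
    [NormedAddCommGroup F] [InnerProductSpace ℝ F]
    [NormedAddCommGroup E] [InnerProductSpace ℝ E] (V : Set F) (γ : F → E) : Prop where
  isOpen : IsOpen V
  zero_mem : (0 : F) ∈ V
  contDiffOn : ContDiffOn ℝ ∞ γ V
  injOn : InjOn γ V
  immersion : ∀ x ∈ V, Function.Injective (fderiv ℝ γ x)

/-- The parametrised extension operator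
`(E g)(ξ) = ∫_U exp (-2πi ⟨ξ, γ x⟩) g(x) dx`; here `Real.fourierChar t = exp (2πi t)`. -/
def extensionOp {F E : Type*} [MeasureSpace F]
    [NormedAddCommGroup E] [InnerProductSpace ℝ E]
    (U : Set F) (γ : F → E) (g : F → ℂ) (ξ : E) : ℂ :=
  ∫ x in U, Real.fourierChar (-(inner ℝ ξ (γ x))) • g x

/-- `C` is an admissible constant in the Brascamp--Lieb inequality
`∫_E ∏ f_j(L_j x)^{p_j} dx ≤ C ∏ (∫ f_j)^{p_j}`, over all nonnegative integrable `f_j`. -/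
def IsBrascampLiebBound {ι : Type*} [Fintype ι] {E : Type*} [MeasureSpace E]
    [NormedAddCommGroup E] [InnerProductSpace ℝ E] {F : ι → Type*}
    [∀ j, MeasureSpace (F j)] [∀ j, NormedAddCommGroup (F j)] [∀ j, InnerProductSpace ℝ (F j)]
    (L : ∀ j, E →L[ℝ] F j) (p : ι → ℝ) (C : ℝ≥0∞) : Prop :=
  ∀ f : ∀ j, F j → ℝ≥0, (∀ j, Measurable (f j)) → (∀ j, ∫⁻ y, (f j y : ℝ≥0∞) ≠ ⊤) →
    ∫⁻ x, ∏ j, (f j (L j x) : ℝ≥0∞) ^ p j ≤ C * ∏ j, (∫⁻ y, (f j y : ℝ≥0∞)) ^ p j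

/-- The Brascamp--Lieb constant `BL(L, p) ∈ [0, ∞]`: the smallest admissible constant. -/
def brascampLiebConst {ι : Type*} [Fintype ι] {E : Type*} [MeasureSpace E]
    [NormedAddCommGroup E] [InnerProductSpace ℝ E] {F : ι → Type*}
    [∀ j, MeasureSpace (F j)] [∀ j, NormedAddCommGroup (F j)] [∀ j, InnerProductSpace ℝ (F j)]
    (L : ∀ j, E →L[ℝ] F j) (p : ι → ℝ) : ℝ≥0∞ :=
  sInf {C | IsBrascampLiebBound L p C}

end

/-!
# Local multilinear restriction estimates for curves

Write `v j = (γ j)'(0)`, so that `L j x = ⟨v j, x⟩`. The exponent vectors `q` for which the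
conclusion holds form a convex set, by Hölder's inequality (`convex_restrictionExponents`). It
therefore suffices to show that `p` is a convex combination of indicators `1_I` of index sets
`I` for which `(v j)_{j ∈ I}` is a basis of `ℝⁿ`, and that each such `1_I` is admissible.

*Vertices.* For a basis, `∏_{j ∈ I} E_j g_j (ξ)` is the integral of `e^{-2πi⟨ξ, Γ x⟩} ∏ g_j(x_j)`,
where `Γ x = ∑_j γ_j(x_j)`. The derivative of `Γ` at `0` is invertible, so `|Γ x - Γ y| ≥ c |x - y|`
near `0` (`exists_mul_norm_le_norm_sum_sub`). Inserting the weight `e^{-πε|ξ|²}` and integrating in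
`ξ` first turns the squared `L²` norm into a form with the positive kernel `K_ε(Γ x - Γ y)`,
where `K_ε` is a normalised radially decreasing Gaussian. Its marginals are bounded by
`∫ K_ε(c y) dy = c^{-n}`, uniformly in `ε`, so Schur's test and `ε → 0` give the bound
(`lintegral_enorm_sq_integral_fourierChar_le`, `lintegral_prod_enorm_extensionOp_sq_le`). This
replaces the change of variables and Plancherel's theorem.

*Base polytope.* Testing the Brascamp–Lieb inequality on indicators of `[-R^{a_j}, R^{a_j}]` bounds
the volume of `{x | ∀ j, |⟨v j, x⟩| ≤ R^{a_j}}` by a multiple of `R^{∑ a_j p_j}`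
(`volume_le_of_isBrascampLiebBound`). For a basis `I` of minimal weight `∑_{j ∈ I} a_j`, each `v j`
lies in the span of the `v i`, `i ∈ I`, with `a_i ≤ a_j`; hence that volume is at least
a multiple of `R^{∑_I a_j}`. That the `v j` span is part of the conclusion: the unit vectors are
adjoined with a prohibitive weight. Letting `R → ∞`, every linear functional `a` satisfies
`min_I ∑_{j ∈ I} a_j ≤ ∑ a_j p_j`, and the Hahn–Banach theorem puts `p` in the convex hull
(`mem_convexHull_selectionExponent`).
-/

/-! ### Gaussian regularisation of an oscillatory integral -/

/-- The `L¹`-normalised Gaussian `z ↦ ε^{-d/2} exp (-π |z|² / ε)`, `d = dim E`, which is the Fourier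
transform of `ξ ↦ exp (-π ε |ξ|²)`. -/
noncomputable def gaussianKernel {E : Type*} [NormedAddCommGroup E] [InnerProductSpace ℝ E]
    (ε : ℝ) (z : E) : ℝ :=
  (1 / ε) ^ (Module.finrank ℝ E / 2 : ℝ) * Real.exp (-(Real.pi / ε) * ‖z‖ ^ 2)

section Gaussian

variable {E : Type*} [NormedAddCommGroup E] [InnerProductSpace ℝ E]

lemma gaussianKernel_nonneg {ε : ℝ} (hε : 0 < ε) (z : E) : 0 ≤ gaussianKernel ε z := by
  unfold gaussianKernel; positivity

lemma gaussianKernel_neg (ε : ℝ) (z : E) : gaussianKernel ε (-z) = gaussianKernel ε z := by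
  simp [gaussianKernel]

lemma continuous_gaussianKernel (ε : ℝ) : Continuous (gaussianKernel ε : E → ℝ) := by
  unfold gaussianKernel; fun_prop

variable [MeasurableSpace E] [BorelSpace E]

lemma aestronglyMeasurable_fourierChar_smul [SecondCountableTopology E]
    {X : Type*} [MeasurableSpace X] {μ : Measure X} [SFinite μ] {ν : Measure E}
    {Γ : X → E} (hΓ : AEMeasurable Γ μ) {F : X → ℂ} (hF : AEStronglyMeasurable F μ) :
    AEStronglyMeasurable (fun q : E × X => Real.fourierChar (-(inner ℝ q.1 (Γ q.2))) • F q.2)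
      (ν.prod μ) := by
  have h1 : AEMeasurable (fun q : E × X => Γ q.2) (ν.prod μ) := hΓ.comp_snd
  have h2 : AEMeasurable (fun q : E × X => -(inner ℝ q.1 (Γ q.2))) (ν.prod μ) :=
    (measurable_fst.aemeasurable.inner h1).neg
  have h3 : AEMeasurable (fun q : E × X => (Real.fourierChar (-(inner ℝ q.1 (Γ q.2))) : ℂ))
      (ν.prod μ) :=
    ((continuous_subtype_val.comp Real.continuous_fourierChar).measurable).comp_aemeasurable h2
  exact h3.aestronglyMeasurable.mul hF.comp_snd

variable [FiniteDimensional ℝ E]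

lemma integrable_exp_neg_sq_norm {b : ℝ} (hb : 0 < b) :
    Integrable (fun ξ : E => Real.exp (-b * ‖ξ‖ ^ 2)) := by
  have h := (GaussianFourier.integrable_cexp_neg_mul_sq_norm_add (V := E) (b := b)
    (by simpa using hb) 0 0).norm
  refine h.congr (Filter.Eventually.of_forall fun ξ => ?_)
  simp [Complex.norm_exp, ← Complex.ofReal_pow]

lemma integral_exp_mul_fourierChar {ε : ℝ} (hε : 0 < ε) (z : E) :
    ∫ ξ : E, (Real.exp (-(Real.pi * ε) * ‖ξ‖ ^ 2) : ℂ) * (Real.fourierChar (-(inner ℝ ξ z)) : ℂ) =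
      gaussianKernel ε z := by
  have hb : (0 : ℝ) < ((Real.pi * ε : ℝ) : ℂ).re := by simpa using by positivity
  have h := GaussianFourier.integral_cexp_neg_mul_sq_norm_add (V := E) hb
    (-2 * Real.pi * Complex.I) z
  have hpi : (Real.pi : ℂ) ≠ 0 := by exact_mod_cast Real.pi_ne_zero
  have hε' : (ε : ℂ) ≠ 0 := by exact_mod_cast hε.ne'
  convert h using 1
  · refine integral_congr_ae (Filter.Eventually.of_forall fun ξ => ?_)
    simp only [Real.fourierChar_apply, Complex.ofReal_exp, ← Complex.exp_add]
    congr 1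
    rw [real_inner_comm]
    push_cast
    ring
  · have h1 : (Real.pi : ℂ) / ((Real.pi * ε : ℝ) : ℂ) = ((1 / ε : ℝ) : ℂ) := by
      push_cast; field_simp
    have h2 : (-2 * (Real.pi : ℂ) * Complex.I) ^ 2 * (‖z‖ : ℂ) ^ 2 / (4 * ((Real.pi * ε : ℝ) : ℂ))
        = ((-(Real.pi / ε) * ‖z‖ ^ 2 : ℝ) : ℂ) := by
      push_cast
      rw [mul_pow, Complex.I_sq]
      field_simp
      ring
    rw [h1, h2, gaussianKernel, Complex.ofReal_mul, Complex.ofReal_cpow (by positivity),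
      Complex.ofReal_exp]
    push_cast
    rfl

lemma lintegral_gaussianKernel_smul {ε c : ℝ} (hε : 0 < ε) (hc : 0 < c) :
    ∫⁻ y : E, ENNReal.ofReal (gaussianKernel ε (c • y)) =
      ENNReal.ofReal ((1 / c ^ 2) ^ (Module.finrank ℝ E / 2 : ℝ)) := by
  have hb : 0 < Real.pi / ε * c ^ 2 := by positivity
  have h : ∀ y : E, gaussianKernel ε (c • y) = (1 / ε) ^ (Module.finrank ℝ E / 2 : ℝ) *
      Real.exp (-(Real.pi / ε * c ^ 2) * ‖y‖ ^ 2) := by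
    intro y
    rw [gaussianKernel, norm_smul, Real.norm_of_nonneg hc.le]
    ring_nf
  simp_rw [h]
  rw [← ofReal_integral_eq_lintegral_ofReal ((integrable_exp_neg_sq_norm hb).const_mul _)
    (Filter.Eventually.of_forall fun y => by positivity), integral_const_mul,
    GaussianFourier.integral_rexp_neg_mul_sq_norm hb, ← Real.mul_rpow (by positivity)
    (by positivity)]
  congr 2
  field_simp

variable {X : Type*} [MeasurableSpace X] {μ : Measure X} [SFinite μ]

/-- The Gaussian-regularised form of `lintegral_enorm_sq_integral_fourierChar_le`: expanding the
square and integrating in `ξ` first leaves a positive kernel, to which Schur's test applies. -/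
lemma lintegral_enorm_sq_mul_exp_le {Γ : X → E} (hΓ : AEMeasurable Γ μ) {F : X → ℂ}
    (hF : Integrable F μ) {A : ℝ≥0∞} {ε : ℝ} (hε : 0 < ε)
    (hA : ∀ᵐ x ∂μ, ∫⁻ y, ENNReal.ofReal (gaussianKernel ε (Γ x - Γ y)) ∂μ ≤ A) :
    ∫⁻ ξ : E, ‖∫ x, Real.fourierChar (-(inner ℝ ξ (Γ x))) • F x ∂μ‖ₑ ^ 2 *
      ENNReal.ofReal (Real.exp (-(Real.pi * ε) * ‖ξ‖ ^ 2)) ≤ A * ∫⁻ x, ‖F x‖ₑ ^ 2 ∂μ := by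
  set w : E → ℝ := fun ξ => Real.exp (-(Real.pi * ε) * ‖ξ‖ ^ 2) with hw
  set G : E → X → ℂ := fun ξ x => Real.fourierChar (-(inner ℝ ξ (Γ x))) • F x with hG
  set Φ : E → ℂ := fun ξ => ∫ x, G ξ x ∂μ with hΦ
  set H : E → X × X → ℂ := fun ξ q => (w ξ : ℂ) * (G ξ q.1 * (starRingEnd ℂ) (G ξ q.2)) with hH
  have hwint : Integrable w := integrable_exp_neg_sq_norm (by positivity)
  have hHm : AEStronglyMeasurable (Function.uncurry H) (volume.prod (μ.prod μ)) := by
    have hΓ1 : AEMeasurable (fun q : X × X => Γ q.1) (μ.prod μ) := hΓ.comp_fst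
    have hΓ2 : AEMeasurable (fun q : X × X => Γ q.2) (μ.prod μ) := hΓ.comp_snd
    have h1 := aestronglyMeasurable_fourierChar_smul (ν := (volume : Measure E)) hΓ1
      (hF.1.comp_fst (ν := μ))
    have h2 := aestronglyMeasurable_fourierChar_smul (ν := (volume : Measure E)) hΓ2
      (hF.1.comp_snd (μ := μ))
    have h3 : AEStronglyMeasurable (fun q : E × (X × X) => (w q.1 : ℂ)) (volume.prod (μ.prod μ)) :=
      (by fun_prop : Continuous fun ξ : E => (w ξ : ℂ)).aestronglyMeasurable.comp_fst
    exact h3.mul (h1.mul (Complex.continuous_conj.comp_aestronglyMeasurable h2))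
  -- Absolute convergence of the triple integral, so that Fubini applies.
  have hHint : Integrable (Function.uncurry H) (volume.prod (μ.prod μ)) := by
    have h := hwint.mul_prod (hF.norm.mul_prod hF.norm)
    refine h.mono hHm (Filter.Eventually.of_forall fun q => le_of_eq ?_)
    simp only [Function.uncurry, hH, hG, norm_mul, Complex.norm_real, RCLike.norm_conj, norm_norm,
      Circle.norm_smul]
  have hHξ : ∀ ξ, ∫ q, H ξ q ∂(μ.prod μ) = ((w ξ * ‖Φ ξ‖ ^ 2 : ℝ) : ℂ) := by
    intro ξ
    simp only [hH]
    rw [integral_const_mul, integral_prod_mul (G ξ) (fun y => (starRingEnd ℂ) (G ξ y)),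
      integral_conj, Complex.mul_conj, Complex.normSq_eq_norm_sq]
    push_cast
    rfl
  have hint : Integrable (fun ξ => w ξ * ‖Φ ξ‖ ^ 2) := by
    have h := hHint.integral_prod_left
    simp only [Function.uncurry, hHξ] at h
    exact_mod_cast h.re
  have hK : ∀ q : X × X, ‖∫ ξ, H ξ q‖ₑ =
      ‖F q.1‖ₑ * ‖F q.2‖ₑ * ENNReal.ofReal (gaussianKernel ε (Γ q.1 - Γ q.2)) := by
    intro q
    have : ∀ ξ, H ξ q = F q.1 * (starRingEnd ℂ) (F q.2) *
        ((Real.exp (-(Real.pi * ε) * ‖ξ‖ ^ 2) : ℂ) *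
          (Real.fourierChar (-(inner ℝ ξ (Γ q.1 - Γ q.2))) : ℂ)) := by
      intro ξ
      have e1 : (Real.fourierChar (-(inner ℝ ξ (Γ q.1 - Γ q.2))) : ℂ) =
          (Real.fourierChar (-(inner ℝ ξ (Γ q.1))) : ℂ) *
            (starRingEnd ℂ) (Real.fourierChar (-(inner ℝ ξ (Γ q.2))) : ℂ) := by
        rw [← Circle.coe_inv_eq_conj, ← AddChar.map_neg_eq_inv, ← Circle.coe_mul,
          ← AddChar.map_add_eq_mul, inner_sub_right]
        congr 2
        ring
      rw [e1]
      simp only [hH, hG, hw, Circle.smul_def, smul_eq_mul, map_mul]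
      push_cast
      ring
    simp_rw [this]
    rw [integral_const_mul, integral_exp_mul_fourierChar hε, enorm_mul, enorm_mul, RCLike.enorm_conj]
    congr 1
    rw [← ofReal_norm, Complex.norm_real, Real.norm_of_nonneg (gaussianKernel_nonneg hε _)]
  have hKm : AEMeasurable (fun q : X × X => ENNReal.ofReal (gaussianKernel ε (Γ q.1 - Γ q.2)))
      (μ.prod μ) :=
    ENNReal.measurable_ofReal.comp_aemeasurable
      ((continuous_gaussianKernel ε).measurable.comp_aemeasurable
        (hΓ.comp_fst.sub hΓ.comp_snd))
  have hFm : AEMeasurable (fun x => ‖F x‖ₑ ^ 2) μ := hF.1.enorm.pow_const 2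
  have hm1 : AEMeasurable (fun q : X × X => ‖F q.1‖ₑ ^ 2 *
      ENNReal.ofReal (gaussianKernel ε (Γ q.1 - Γ q.2))) (μ.prod μ) := hFm.comp_fst.mul hKm
  have hm2 : AEMeasurable (fun q : X × X => ‖F q.2‖ₑ ^ 2 *
      ENNReal.ofReal (gaussianKernel ε (Γ q.1 - Γ q.2))) (μ.prod μ) := hFm.comp_snd.mul hKm
  have hS1 : ∫⁻ q, ‖F q.1‖ₑ ^ 2 * ENNReal.ofReal (gaussianKernel ε (Γ q.1 - Γ q.2)) ∂(μ.prod μ) ≤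
      A * ∫⁻ x, ‖F x‖ₑ ^ 2 ∂μ := by
    rw [lintegral_prod _ hm1, mul_comm A, ← lintegral_mul_const'' _ hFm]
    refine lintegral_mono_ae ?_
    filter_upwards [hA] with x hx
    rw [lintegral_const_mul' _ _ (by simp)]
    gcongr
  have hS2 : ∫⁻ q, ‖F q.2‖ₑ ^ 2 * ENNReal.ofReal (gaussianKernel ε (Γ q.1 - Γ q.2)) ∂(μ.prod μ) ≤
      A * ∫⁻ x, ‖F x‖ₑ ^ 2 ∂μ := by
    rw [lintegral_prod_symm _ hm2, mul_comm A, ← lintegral_mul_const'' _ hFm]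
    refine lintegral_mono_ae ?_
    filter_upwards [hA] with x hx
    rw [lintegral_const_mul' _ _ (by simp)]
    gcongr
    refine le_trans (le_of_eq ?_) hx
    refine lintegral_congr fun y => ?_
    rw [← gaussianKernel_neg, neg_sub]
  have hmain : ∫⁻ ξ, ‖Φ ξ‖ₑ ^ 2 * ENNReal.ofReal (w ξ) ≤
      ∫⁻ q, ‖F q.1‖ₑ * ‖F q.2‖ₑ * ENNReal.ofReal (gaussianKernel ε (Γ q.1 - Γ q.2)) ∂(μ.prod μ) := by
    calc ∫⁻ ξ, ‖Φ ξ‖ₑ ^ 2 * ENNReal.ofReal (w ξ)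
        = ∫⁻ ξ, ENNReal.ofReal (w ξ * ‖Φ ξ‖ ^ 2) := by
          refine lintegral_congr fun ξ => ?_
          rw [ENNReal.ofReal_mul (Real.exp_pos _).le, mul_comm, ENNReal.ofReal_pow (norm_nonneg _),
            ofReal_norm]
      _ = ENNReal.ofReal (∫ ξ, w ξ * ‖Φ ξ‖ ^ 2) :=
          (ofReal_integral_eq_lintegral_ofReal hint (Filter.Eventually.of_forall fun ξ =>
            mul_nonneg (Real.exp_pos _).le (by positivity))).symm
      _ ≤ ‖((∫ ξ, w ξ * ‖Φ ξ‖ ^ 2 : ℝ) : ℂ)‖ₑ := by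
          rw [← ofReal_norm, Complex.norm_real]
          exact ENNReal.ofReal_le_ofReal (le_abs_self _)
      _ = ‖∫ q, (∫ ξ, H ξ q) ∂(μ.prod μ)‖ₑ := by
          rw [← integral_integral_swap hHint]
          simp_rw [hHξ]
          rw [integral_complex_ofReal]
      _ ≤ ∫⁻ q, ‖∫ ξ, H ξ q‖ₑ ∂(μ.prod μ) := enorm_integral_le_lintegral_enorm _
      _ = _ := lintegral_congr hK
  -- Schur's test: `2ab ≤ a² + b²`, and the kernel has bounded marginals.
  have hYoung : ∀ a b : ℂ, 2 * (‖a‖ₑ * ‖b‖ₑ) ≤ ‖a‖ₑ ^ 2 + ‖b‖ₑ ^ 2 := by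
    intro a b
    have h : 2 * ‖a‖₊ * ‖b‖₊ ≤ ‖a‖₊ ^ 2 + ‖b‖₊ ^ 2 := two_mul_le_add_sq _ _
    rw [← mul_assoc]
    simp only [enorm_eq_nnnorm]
    exact_mod_cast h
  have htwo : 2 * ∫⁻ ξ, ‖Φ ξ‖ₑ ^ 2 * ENNReal.ofReal (w ξ) ≤ 2 * (A * ∫⁻ x, ‖F x‖ₑ ^ 2 ∂μ) := by
    calc 2 * ∫⁻ ξ, ‖Φ ξ‖ₑ ^ 2 * ENNReal.ofReal (w ξ)
        ≤ 2 * ∫⁻ q, ‖F q.1‖ₑ * ‖F q.2‖ₑ *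
            ENNReal.ofReal (gaussianKernel ε (Γ q.1 - Γ q.2)) ∂(μ.prod μ) := by gcongr
      _ = ∫⁻ q, 2 * (‖F q.1‖ₑ * ‖F q.2‖ₑ *
            ENNReal.ofReal (gaussianKernel ε (Γ q.1 - Γ q.2))) ∂(μ.prod μ) :=
          (lintegral_const_mul' _ _ (by simp)).symm
      _ ≤ ∫⁻ q, (‖F q.1‖ₑ ^ 2 * ENNReal.ofReal (gaussianKernel ε (Γ q.1 - Γ q.2)) +
            ‖F q.2‖ₑ ^ 2 * ENNReal.ofReal (gaussianKernel ε (Γ q.1 - Γ q.2))) ∂(μ.prod μ) := by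
          refine lintegral_mono fun q => ?_
          rw [← mul_assoc, ← add_mul]
          gcongr
          exact hYoung _ _
      _ ≤ A * ∫⁻ x, ‖F x‖ₑ ^ 2 ∂μ + A * ∫⁻ x, ‖F x‖ₑ ^ 2 ∂μ := by
          rw [lintegral_add_left' hm1]
          gcongr
      _ = _ := (two_mul _).symm
  exact (ENNReal.mul_le_mul_iff_right (by simp) (by simp)).1 htwo

/-- An `L²` bound for `F ↦ ∫ e^{-2πi⟨ξ, Γ x⟩} F x dμ x`. The hypothesis says that the push-forward of
`μ` under `Γ` has, at every scale, density at most `A`; no injectivity or change of variables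
is needed. -/
theorem lintegral_enorm_sq_integral_fourierChar_le {Γ : X → E} (hΓ : AEMeasurable Γ μ) {F : X → ℂ}
    (hF : Integrable F μ) {A : ℝ≥0∞}
    (hA : ∀ ε : ℝ, 0 < ε → ∀ᵐ x ∂μ, ∫⁻ y, ENNReal.ofReal (gaussianKernel ε (Γ x - Γ y)) ∂μ ≤ A) :
    ∫⁻ ξ : E, ‖∫ x, Real.fourierChar (-(inner ℝ ξ (Γ x))) • F x ∂μ‖ₑ ^ 2 ≤
      A * ∫⁻ x, ‖F x‖ₑ ^ 2 ∂μ := by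
  set Φ : E → ℂ := fun ξ => ∫ x, Real.fourierChar (-(inner ℝ ξ (Γ x))) • F x ∂μ with hΦ
  have hΦm : AEStronglyMeasurable Φ :=
    (aestronglyMeasurable_fourierChar_smul (ν := (volume : Measure E)) hΓ hF.1).integral_prod_right'
  set f : ℕ → E → ℝ≥0∞ := fun k ξ => ‖Φ ξ‖ₑ ^ 2 *
    ENNReal.ofReal (Real.exp (-(Real.pi * (1 / ((k : ℝ) + 1))) * ‖ξ‖ ^ 2)) with hf
  have hlim : ∀ ξ, Filter.Tendsto (fun k => f k ξ) Filter.atTop (nhds (‖Φ ξ‖ₑ ^ 2)) := by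
    intro ξ
    have h0 : Filter.Tendsto (fun k : ℕ => -(Real.pi * (1 / ((k : ℝ) + 1))) * ‖ξ‖ ^ 2)
        Filter.atTop (nhds 0) := by
      simpa using
        ((tendsto_one_div_add_atTop_nhds_zero_nat (𝕜 := ℝ)).const_mul Real.pi).neg.mul_const (‖ξ‖ ^ 2)
    have h1 := ENNReal.tendsto_ofReal ((Real.continuous_exp.tendsto 0).comp h0)
    have h2 := ENNReal.Tendsto.const_mul (a := ‖Φ ξ‖ₑ ^ 2) h1 (Or.inr (by simp))
    simpa [hf] using h2
  calc ∫⁻ ξ, ‖Φ ξ‖ₑ ^ 2 = ∫⁻ ξ, Filter.liminf (fun k => f k ξ) Filter.atTop :=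
        lintegral_congr fun ξ => (hlim ξ).liminf_eq.symm
    _ ≤ Filter.liminf (fun k => ∫⁻ ξ, f k ξ) Filter.atTop := by
        refine lintegral_liminf_le' fun k => ?_
        exact (hΦm.enorm.pow_const 2).mul
          (by fun_prop : Measurable fun ξ : E => ENNReal.ofReal
            (Real.exp (-(Real.pi * (1 / ((k : ℝ) + 1))) * ‖ξ‖ ^ 2))).aemeasurable
    _ ≤ A * ∫⁻ x, ‖F x‖ₑ ^ 2 ∂μ := by
        refine Filter.liminf_le_of_le (by isBoundedDefault) fun b hb => ?_
        obtain ⟨k, hk⟩ := hb.exists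
        have hpos : (0 : ℝ) < 1 / ((k : ℝ) + 1) := by positivity
        exact hk.trans (lintegral_enorm_sq_mul_exp_le hΓ hF hpos (hA _ hpos))

end Gaussian

/-! ### The multilinear estimate for transversal curves -/

lemma gaussianKernel_le_of_norm_le {E : Type*} [NormedAddCommGroup E] [InnerProductSpace ℝ E]
    {ε : ℝ} (hε : 0 < ε) {w z : E} (h : ‖w‖ ≤ ‖z‖) : gaussianKernel ε z ≤ gaussianKernel ε w := by
  have : 0 < Real.pi / ε := by positivity
  unfold gaussianKernel
  gcongr ?_ * Real.exp ?_
  rw [neg_mul, neg_mul, neg_le_neg_iff]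
  gcongr

/-- If the velocities at `0` are linearly independent, then the sum map
`x ↦ ∑ i, γ i (x i)` is expanding, up to a constant, near `0`. -/
lemma exists_mul_norm_le_norm_sum_sub {ι E : Type*} [Fintype ι] [NormedAddCommGroup E]
    [NormedSpace ℝ E] {γ : ι → ℝ → E} {v : ι → E}
    (hγ : ∀ i, HasStrictDerivAt (γ i) (v i) 0) (hv : LinearIndependent ℝ v) :
    ∃ δ > 0, ∃ c : ℝ, 0 < c ∧ ∀ x y : ι → ℝ, (∀ i, |x i| < δ) → (∀ i, |y i| < δ) →
      c * ‖WithLp.toLp 2 (x - y)‖ ≤ ‖∑ i, γ i (x i) - ∑ i, γ i (y i)‖ := by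
  set L : (ι → ℝ) →L[ℝ] E :=
    ∑ i, (ContinuousLinearMap.toSpanSingleton ℝ (v i)).comp (ContinuousLinearMap.proj i) with hL
  have hLx : ∀ x, L x = ∑ i, x i • v i := fun x => by simp [hL]
  have hstrict : HasStrictFDerivAt (fun x : ι → ℝ => ∑ i, γ i (x i)) L 0 := by
    refine HasStrictFDerivAt.fun_sum fun i _ => ?_
    have h := (hγ i).hasStrictFDerivAt
    exact HasStrictFDerivAt.comp (f := fun x : ι → ℝ => x i) 0 (by simpa using h)
      (ContinuousLinearMap.proj (R := ℝ) (φ := fun _ : ι => ℝ) i).hasStrictFDerivAt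
  have hker : LinearMap.ker (L : (ι → ℝ) →ₗ[ℝ] E) = ⊥ := by
    rw [LinearMap.ker_eq_bot']
    intro x hx
    ext i
    exact Fintype.linearIndependent_iff.1 hv x (by rw [← hLx]; exact hx) i
  obtain ⟨K, hK, hLK⟩ := LinearMap.exists_antilipschitzWith (L : (ι → ℝ) →ₗ[ℝ] E) hker
  have hK' : (0 : ℝ) < K := hK
  have hLlow : ∀ z, ‖z‖ ≤ K * ‖L z‖ := fun z => by
    simpa [dist_zero_right] using hLK.le_mul_dist z 0
  have hev := hstrict.isLittleO.def (c := 1 / (2 * K)) (by positivity)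
  obtain ⟨δ, hδ, hball⟩ := Metric.eventually_nhds_iff.1 hev
  set T : (ι → ℝ) →L[ℝ] EuclideanSpace ℝ ι :=
    ((EuclideanSpace.equiv ι ℝ).symm : (ι → ℝ) →L[ℝ] EuclideanSpace ℝ ι) with hT
  refine ⟨δ, hδ, 1 / (2 * K * (‖T‖ + 1)), by positivity, fun x y hx hy => ?_⟩
  have hxy : dist (x, y) ((0 : ι → ℝ), (0 : ι → ℝ)) < δ := by
    rw [Prod.dist_eq, dist_zero_right, dist_zero_right, max_lt_iff, pi_norm_lt_iff hδ,
      pi_norm_lt_iff hδ]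
    exact ⟨hx, hy⟩
  have h1 := hball hxy
  have h2 := hLlow (x - y)
  have h3 : ‖WithLp.toLp 2 (x - y)‖ ≤ (‖T‖ + 1) * ‖x - y‖ :=
    (T.le_opNorm (x - y)).trans (by gcongr; linarith)
  have h4 : ‖L (x - y)‖ ≤ ‖∑ i, γ i (x i) - ∑ i, γ i (y i)‖ + 1 / (2 * K) * ‖x - y‖ := by
    calc ‖L (x - y)‖ = ‖(∑ i, γ i (x i) - ∑ i, γ i (y i)) -
          (∑ i, γ i (x i) - ∑ i, γ i (y i) - L (x - y))‖ := by rw [sub_sub_cancel]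
      _ ≤ _ := (norm_sub_le _ _).trans (by gcongr)
  have h5 : 1 / (2 * K) * ‖x - y‖ ≤ ‖∑ i, γ i (x i) - ∑ i, γ i (y i)‖ := by
    have h6 : 1 / K * ‖x - y‖ ≤ ‖L (x - y)‖ := by
      rw [div_mul_eq_mul_div, one_mul, div_le_iff₀ hK', mul_comm]
      exact h2
    have h7 : 1 / (K : ℝ) * ‖x - y‖ = 1 / (2 * K) * ‖x - y‖ + 1 / (2 * K) * ‖x - y‖ := by
      field_simp; ring
    linarith
  refine le_trans ?_ h5
  calc 1 / (2 * K * (‖T‖ + 1)) * ‖WithLp.toLp 2 (x - y)‖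
      ≤ 1 / (2 * K * (‖T‖ + 1)) * ((‖T‖ + 1) * ‖x - y‖) := by gcongr
    _ = 1 / (2 * K) * ‖x - y‖ := by
      have : ‖T‖ + 1 ≠ 0 := by positivity
      field_simp

lemma lintegral_fintype_prod_enorm_sq {ι : Type*} [Fintype ι] {X : Type*} [MeasurableSpace X]
    {μ : ι → Measure X} [∀ i, SigmaFinite (μ i)] {g : ι → X → ℂ} (hg : ∀ i, MemLp (g i) 2 (μ i)) :
    ∫⁻ x, ‖∏ i, g i (x i)‖ₑ ^ 2 ∂(Measure.pi μ) = ∏ i, eLpNorm (g i) 2 (μ i) ^ 2 := by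
  have hint : ∀ i, Integrable (fun x => ‖g i x‖ ^ 2) (μ i) := fun i =>
    (hg i).integrable_norm_pow two_ne_zero
  have h1 : ∀ i, eLpNorm (g i) 2 (μ i) ^ 2 = ENNReal.ofReal (∫ x, ‖g i x‖ ^ 2 ∂(μ i)) := by
    intro i
    have h := eLpNorm_nnreal_pow_eq_lintegral (f := g i) (μ := μ i) (p := 2) two_ne_zero
    rw [ofReal_integral_eq_lintegral_ofReal (hint i)
      (Filter.Eventually.of_forall fun x => by positivity)]
    simp only [ENNReal.ofReal_pow (norm_nonneg _), ofReal_norm]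
    simpa using h
  simp_rw [h1]
  rw [← ENNReal.ofReal_prod_of_nonneg (fun i _ => integral_nonneg fun x => by positivity),
    ← integral_fintype_prod_eq_prod (fun i x => ‖g i x‖ ^ 2),
    ofReal_integral_eq_lintegral_ofReal (Integrable.fintype_prod hint)
      (Filter.Eventually.of_forall fun x => Finset.prod_nonneg fun i _ => by positivity)]
  refine lintegral_congr fun x => ?_
  rw [Finset.prod_pow, ← norm_prod, ENNReal.ofReal_pow (norm_nonneg _), ofReal_norm]

/-- For curves with linearly independent velocities at `0`, the product of the
extension operators is the oscillatory integral of a tensor product over the sum map, so that it is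
bounded on `L²`. -/
theorem lintegral_prod_enorm_extensionOp_sq_le {n : ℕ} {γ : Fin n → ℝ → EuclideanSpace ℝ (Fin n)}
    {v : Fin n → EuclideanSpace ℝ (Fin n)} (hγ : ∀ i, HasStrictDerivAt (γ i) (v i) 0)
    (hv : LinearIndependent ℝ v) :
    ∃ δ > 0, ∃ C : ℝ≥0, ∀ U : Fin n → Set ℝ, (∀ i, MeasurableSet (U i)) →
      (∀ i, ContinuousOn (γ i) (U i)) → (∀ i, U i ⊆ Metric.ball 0 δ) →
      ∀ g : Fin n → ℝ → ℂ, (∀ i, MemLp (g i) 2 (volume.restrict (U i))) →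
        ∫⁻ ξ, ∏ i, ‖extensionOp (U i) (γ i) (g i) ξ‖ₑ ^ 2 ≤
          C * ∏ i, eLpNorm (g i) 2 (volume.restrict (U i)) ^ 2 := by
  obtain ⟨δ, hδ, c, hc, hexp⟩ := exists_mul_norm_le_norm_sum_sub hγ hv
  refine ⟨δ, hδ, Real.toNNReal ((1 / c ^ 2) ^
    (Module.finrank ℝ (EuclideanSpace ℝ (Fin n)) / 2 : ℝ)), fun U hUm hUc hUδ g hg => ?_⟩
  have hfin : ∀ i, IsFiniteMeasure (volume.restrict (U i)) := fun i =>
    isFiniteMeasure_restrict.2 ((measure_mono (hUδ i)).trans_lt measure_ball_lt_top).ne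
  set μ : Measure (Fin n → ℝ) := Measure.pi fun i => volume.restrict (U i) with hμ
  have hμ' : μ = volume.restrict (univ.pi U) := by
    rw [hμ, ← Measure.restrict_pi_pi, volume_pi]
  set Γ : (Fin n → ℝ) → EuclideanSpace ℝ (Fin n) := fun x => ∑ i, γ i (x i) with hΓ
  have hΓm : AEMeasurable Γ μ := by
    refine Finset.aemeasurable_fun_sum _ fun i _ => ?_
    exact ((hUc i).aemeasurable (hUm i)).comp_quasiMeasurePreserving
      (Measure.quasiMeasurePreserving_eval _ i)
  have hF : Integrable (fun x : Fin n → ℝ => ∏ i, g i (x i)) μ :=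
    Integrable.fintype_prod fun i => (hg i).integrable one_le_two
  have hprod : ∀ ξ, ∏ i, extensionOp (U i) (γ i) (g i) ξ =
      ∫ x, Real.fourierChar (-(inner ℝ ξ (Γ x))) • ∏ i, g i (x i) ∂μ := by
    intro ξ
    simp only [extensionOp]
    rw [← integral_fintype_prod_eq_prod
      (fun i x => Real.fourierChar (-(inner ℝ ξ (γ i x))) • g i x)]
    refine integral_congr_ae (Filter.Eventually.of_forall fun x => ?_)
    simp only [Circle.smul_def, smul_eq_mul, Finset.prod_mul_distrib, hΓ, inner_sum,
      ← Finset.sum_neg_distrib, Real.fourierChar_apply, Finset.mul_sum, Complex.ofReal_sum,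
      Finset.sum_mul, Complex.exp_sum]
  have hA : ∀ ε : ℝ, 0 < ε → ∀ᵐ x ∂μ,
      ∫⁻ y, ENNReal.ofReal (gaussianKernel ε (Γ x - Γ y)) ∂μ ≤
        ((Real.toNNReal ((1 / c ^ 2) ^ (Module.finrank ℝ (EuclideanSpace ℝ (Fin n)) / 2 : ℝ)) :
          ℝ≥0) : ℝ≥0∞) := by
    intro ε hε
    have hmem : ∀ x ∈ univ.pi U, ∀ i, |x i| < δ := fun x hx i => by
      simpa using hUδ i (hx i (mem_univ i))
    have hae : ∀ᵐ x ∂μ, x ∈ univ.pi U := by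
      rw [hμ']; exact ae_restrict_mem (MeasurableSet.univ_pi hUm)
    filter_upwards [hae] with x hx
    calc ∫⁻ y, ENNReal.ofReal (gaussianKernel ε (Γ x - Γ y)) ∂μ
        ≤ ∫⁻ y, ENNReal.ofReal (gaussianKernel ε (c • (WithLp.toLp 2 x - WithLp.toLp 2 y :
            EuclideanSpace ℝ (Fin n)))) ∂μ := by
          refine lintegral_mono_ae ?_
          filter_upwards [hae] with y hy
          refine ENNReal.ofReal_le_ofReal (gaussianKernel_le_of_norm_le hε ?_)
          rw [norm_smul, Real.norm_of_nonneg hc.le, ← WithLp.toLp_sub]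
          exact hexp x y (hmem x hx) (hmem y hy)
      _ ≤ ∫⁻ y : Fin n → ℝ, ENNReal.ofReal (gaussianKernel ε
            (c • (WithLp.toLp 2 x - WithLp.toLp 2 y : EuclideanSpace ℝ (Fin n)))) := by
          rw [hμ']; exact lintegral_mono' Measure.restrict_le_self le_rfl
      _ = ∫⁻ y : EuclideanSpace ℝ (Fin n), ENNReal.ofReal (gaussianKernel ε
            (c • (WithLp.toLp 2 x - y))) :=
          (PiLp.volume_preserving_toLp (Fin n)).lintegral_comp_emb
            (MeasurableEquiv.toLp 2 _).measurableEmbedding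
            (fun y => ENNReal.ofReal (gaussianKernel ε (c • (WithLp.toLp 2 x - y))))
      _ = ∫⁻ y : EuclideanSpace ℝ (Fin n), ENNReal.ofReal (gaussianKernel ε (c • y)) :=
          lintegral_sub_left_eq_self
            (fun y => ENNReal.ofReal (gaussianKernel ε (c • y))) (WithLp.toLp 2 x)
      _ ≤ _ := (lintegral_gaussianKernel_smul hε hc).le
  have h := lintegral_enorm_sq_integral_fourierChar_le hΓm hF hA
  rw [lintegral_fintype_prod_enorm_sq hg] at h
  refine le_trans (le_of_eq (lintegral_congr fun ξ => ?_)) h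
  simp only [← hprod, Finset.prod_pow, enorm_eq_nnnorm, nnnorm_prod, ENNReal.ofNNReal_finsetProd]

/-! ### Finiteness of the rank-one Brascamp–Lieb constant -/

/-- A basis of minimal total weight selected from a finite family: by exchange, every vector of the
family is spanned by the basis vectors that are no heavier than itself. -/
lemma exists_linearIndependent_forall_weight_le {ι E : Type*} [Finite ι] [AddCommGroup E]
    [Module ℝ E] [FiniteDimensional ℝ E] {n : ℕ} (hn : Module.finrank ℝ E = n) {w : ι → E}
    (hw : ∃ σ : Fin n → ι, LinearIndependent ℝ (w ∘ σ)) (a : ι → ℝ) :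
    ∃ σ : Fin n → ι, LinearIndependent ℝ (w ∘ σ) ∧
      ∀ j, ∃ c : Fin n → ℝ, w j = ∑ i, c i • w (σ i) ∧ ∀ i, c i ≠ 0 → a (σ i) ≤ a j := by
  obtain ⟨σ, hσ, hmin⟩ := Set.exists_min_image {σ : Fin n → ι | LinearIndependent ℝ (w ∘ σ)}
    (fun σ => ∑ i, a (σ i)) (Set.toFinite _) hw
  refine ⟨σ, hσ, fun j => ?_⟩
  have hspan : Submodule.span ℝ (Set.range (w ∘ σ)) = ⊤ :=
    hσ.span_eq_top_of_card_eq_finrank' (by simp [hn])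
  set b := Module.Basis.mk hσ hspan.ge with hb
  have hbσ : ∀ i, b i = w (σ i) := fun i => by simp [hb]
  have hsum : w j = ∑ i, b.repr (w j) i • w (σ i) := by
    simp_rw [← hbσ]
    exact (b.sum_repr (w j)).symm
  refine ⟨fun i => b.repr (w j) i, hsum, fun i hi => ?_⟩
  -- Otherwise exchanging `w (σ i)` for `w j` gives a strictly lighter basis.
  by_contra! hlt
  have hσ' : LinearIndependent ℝ (w ∘ Function.update σ i j) := by
    rw [Function.comp_update]
    refine hσ.update i (w j) ⟨1, one_mem _, b.repr (w j), mem_nonZeroDivisors_of_ne_zero hi, ?_⟩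
    rw [one_smul]
    conv_lhs => rw [← b.linearCombination_repr (w j)]
    congr 1
    simp [hb]
  have h := hmin _ hσ'
  refine absurd h (not_le.2 (Finset.sum_lt_sum (fun k _ => ?_) ⟨i, Finset.mem_univ i, ?_⟩))
  · rcases eq_or_ne k i with rfl | hk
    · simpa using hlt.le
    · simp [Function.update_of_ne hk]
  · simpa using hlt

/-- The set is the preimage of a box under the invertible map `x ↦ (⟨b i, x⟩)_i`. -/
lemma exists_mul_prod_le_volume_forall_abs_inner_le {n : ℕ} {b : Fin n → EuclideanSpace ℝ (Fin n)}
    (hb : LinearIndependent ℝ b) :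
    ∃ κ : ℝ, 0 < κ ∧ ∀ s : Fin n → ℝ, (∀ i, 0 ≤ s i) →
      ENNReal.ofReal (κ * ∏ i, s i) ≤ volume {x | ∀ i, |inner ℝ (b i) x| ≤ s i} := by
  set T : EuclideanSpace ℝ (Fin n) →ₗ[ℝ] EuclideanSpace ℝ (Fin n) :=
    (WithLp.linearEquiv 2 ℝ (Fin n → ℝ)).symm.toLinearMap ∘ₗ
      LinearMap.pi (fun i => (innerSL ℝ (b i)).toLinearMap) with hT
  have hTi : ∀ x i, T x i = inner ℝ (b i) x := fun x i => by simp [hT]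
  have hker : LinearMap.ker T = ⊥ := by
    rw [LinearMap.ker_eq_bot']
    intro x hx
    refine InnerProductSpace.ext_inner_left_basis (𝕜 := ℝ)
      (Module.Basis.mk hb (hb.span_eq_top_of_card_eq_finrank' (by simp)).ge) fun i => ?_
    rw [Module.Basis.mk_apply, ← hTi, hx]
    simp
  have hdet : LinearMap.det T ≠ 0 := by
    intro h
    exact (LinearMap.bot_lt_ker_of_det_eq_zero h).ne' hker
  refine ⟨|(LinearMap.det T)⁻¹| * 2 ^ n, by positivity, fun s hs => ?_⟩
  have hset : {x | ∀ i, |inner ℝ (b i) x| ≤ s i} =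
      T ⁻¹' (WithLp.ofLp ⁻¹' (Set.Icc (-s) s)) := by
    ext x
    simp only [mem_ofPred_eq, mem_preimage, mem_Icc, Pi.le_def, ← forall_and, Pi.neg_apply, abs_le,
      hTi]
  rw [hset, Measure.addHaar_preimage_linearMap _ hdet,
    (PiLp.volume_preserving_ofLp (Fin n)).measure_preimage measurableSet_Icc.nullMeasurableSet,
    Real.volume_Icc_pi, ← ENNReal.ofReal_prod_of_nonneg (fun i _ => by
      simpa using by linarith [hs i]), ← ENNReal.ofReal_mul (abs_nonneg _)]
  refine ENNReal.ofReal_le_ofReal (le_of_eq ?_)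
  have : ∀ i, s i - (-s) i = 2 * s i := fun i => by simp; ring
  simp_rw [this, Finset.prod_mul_distrib]
  simp
  ring

/-- If the volume of the set of points with `|⟨w j, x⟩| ≤ R ^ a j` grows at most like `R ^ e`, then
some basis from the family has total weight at most `e`: take the basis of minimal
weight; up to a constant that set then contains a parallelepiped with sides `R ^ a (σ i)`. -/
lemma exists_linearIndependent_sum_le {ι : Type*} [Fintype ι] {n : ℕ}
    {w : ι → EuclideanSpace ℝ (Fin n)} (hw : ∃ σ : Fin n → ι, LinearIndependent ℝ (w ∘ σ))
    (a : ι → ℝ) {C : ℝ≥0∞} (hC : C ≠ ⊤) {e : ℝ}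
    (h : ∀ R : ℝ, 1 ≤ R →
      volume {x | ∀ j, |inner ℝ (w j) x| ≤ R ^ a j} ≤ C * ENNReal.ofReal (R ^ e)) :
    ∃ σ : Fin n → ι, LinearIndependent ℝ (w ∘ σ) ∧ ∑ i, a (σ i) ≤ e := by
  obtain ⟨σ, hσ, hc⟩ := exists_linearIndependent_forall_weight_le (by simp) hw a
  refine ⟨σ, hσ, ?_⟩
  choose c hcw hca using hc
  obtain ⟨κ, hκ, hvol⟩ := exists_mul_prod_le_volume_forall_abs_inner_le hσ
  -- Shrinking the sides by `M` absorbs the coefficients of the `w j` in the chosen basis.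
  set M : ℝ := 1 + ∑ j, ∑ i, |c j i| with hM
  have hM0 : 0 < M := by positivity
  have hbound : ∀ R : ℝ, 1 ≤ R → κ / M ^ n * R ^ (∑ i, a (σ i)) ≤ C.toReal * R ^ e := by
    intro R hR
    have hR0 : 0 < R := by linarith
    have h1 := hvol (fun i => R ^ a (σ i) / M) (fun i => by positivity)
    have hsub : {x | ∀ i, |inner ℝ ((w ∘ σ) i) x| ≤ R ^ a (σ i) / M} ⊆
        {x | ∀ j, |inner ℝ (w j) x| ≤ R ^ a j} := by
      intro x hx j
      calc |inner ℝ (w j) x| = |∑ i, c j i * inner ℝ (w (σ i)) x| := by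
            conv_lhs => rw [hcw j]
            simp [sum_inner, real_inner_smul_left]
        _ ≤ ∑ i, |c j i| * (R ^ a j / M) := by
            refine (Finset.abs_sum_le_sum_abs _ _).trans (Finset.sum_le_sum fun i _ => ?_)
            rw [abs_mul]
            rcases eq_or_ne (c j i) 0 with h0 | h0
            · simp [h0]
            · gcongr
              refine (hx i).trans ?_
              gcongr
              exact hca j i h0
        _ = (∑ i, |c j i|) / M * R ^ a j := by rw [← Finset.sum_mul]; ring
        _ ≤ 1 * R ^ a j := by
            gcongr
            rw [div_le_one hM0, hM]
            have := Finset.single_le_sum (f := fun j => ∑ i, |c j i|)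
              (fun j _ => by positivity) (Finset.mem_univ j)
            linarith
        _ = R ^ a j := one_mul _
    have h2 := (h1.trans (measure_mono hsub)).trans (h R hR)
    rw [← ENNReal.ofReal_toReal hC, ← ENNReal.ofReal_mul ENNReal.toReal_nonneg,
      ENNReal.ofReal_le_ofReal_iff (by positivity)] at h2
    convert h2 using 1
    rw [Finset.prod_div_distrib, Real.rpow_sum_of_pos hR0]
    simp
    ring
  by_contra! hlt
  have htend := tendsto_rpow_atTop (sub_pos.2 hlt)
  obtain ⟨R, hRbig, hR1⟩ := ((htend.eventually_gt_atTop (C.toReal / (κ / M ^ n))).and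
    (Filter.eventually_ge_atTop 1)).exists
  have hR0 : 0 < R := by linarith
  have h3 := hbound R hR1
  rw [Real.rpow_sub hR0, div_lt_div_iff₀ (by positivity) (by positivity)] at hRbig
  linarith

/-- The exponent vector attached to a selection `σ` of `n` members of a family: it counts the
multiplicity of each index in `σ`, so that it is the indicator of the image when `σ` is
injective. -/
def selectionExponent {ι : Type*} [DecidableEq ι] {n : ℕ} (σ : Fin n → ι) : ι → ℝ :=
  ∑ i, Pi.single (σ i) 1

/-- The unit vectors are adjoined to the family with a weight too large to be selected;
hence no spanning hypothesis is needed. -/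
lemma exists_linearIndependent_sum_le_of_volume_le {ι : Type*} [Fintype ι] {n : ℕ}
    {v : ι → EuclideanSpace ℝ (Fin n)} (a : ι → ℝ) {C : ℝ≥0∞} (hC : C ≠ ⊤) {e : ℝ}
    (h : ∀ R : ℝ, 1 ≤ R →
      volume {x | ∀ j, |inner ℝ (v j) x| ≤ R ^ a j} ≤ C * ENNReal.ofReal (R ^ e)) :
    ∃ σ : Fin n → ι, LinearIndependent ℝ (v ∘ σ) ∧ ∑ i, a (σ i) ≤ e := by
  set S : ℝ := ∑ j, |a j| with hS
  have hS0 : 0 ≤ S := by positivity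
  have haS : ∀ j, -S ≤ a j := fun j => by
    have := Finset.single_le_sum (f := fun j => |a j|) (fun j _ => abs_nonneg _) (Finset.mem_univ j)
    linarith [neg_abs_le (a j)]
  -- Selecting a single unit vector already costs more than `e`: the other weights are `≥ -S`.
  set M : ℝ := |e| + n * S + 1 with hM
  have hM0 : 0 ≤ M := by positivity
  set w : ι ⊕ Fin n → EuclideanSpace ℝ (Fin n) := Sum.elim v (EuclideanSpace.basisFun (Fin n) ℝ)
  obtain ⟨σ, hσ, hσe⟩ := exists_linearIndependent_sum_le (w := w)
    ⟨Sum.inr, (EuclideanSpace.basisFun (Fin n) ℝ).orthonormal.linearIndependent⟩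
    (Sum.elim a fun _ => M) hC
    (fun R hR => (measure_mono (fun x (hx : ∀ j, _) j => hx (Sum.inl j))).trans (h R hR))
  have hterm : ∀ i, 0 ≤ Sum.elim a (fun _ => M) (σ i) + S := by
    intro i
    cases σ i with
    | inl j => simpa using by linarith [haS j]
    | inr k => simpa using by linarith
  have hinl : ∀ i, ∃ j, σ i = Sum.inl j := by
    intro i
    rcases hi : σ i with j | k
    · exact ⟨j, rfl⟩
    · exfalso
      have h1 := Finset.single_le_sum (f := fun i => Sum.elim a (fun _ => M) (σ i) + S)
        (fun i _ => hterm i) (Finset.mem_univ i)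
      simp only [hi, Sum.elim_inr, Finset.sum_add_distrib, Finset.sum_const, Finset.card_univ,
        Fintype.card_fin, nsmul_eq_mul] at h1
      linarith [le_abs_self e]
  choose τ hτ using hinl
  refine ⟨τ, ?_, ?_⟩
  · convert hσ using 1
    ext1 i
    simp [w, hτ]
  · simpa [hτ] using hσe

/-- The volume bounds force `p` into the base polytope of the family `v`, by separation. -/
theorem mem_convexHull_selectionExponent {ι : Type*} [Fintype ι] [DecidableEq ι] {n : ℕ}
    {v : ι → EuclideanSpace ℝ (Fin n)} {p : ι → ℝ} {C : ℝ≥0∞} (hC : C ≠ ⊤)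
    (h : ∀ (a : ι → ℝ) (R : ℝ), 1 ≤ R →
      volume {x | ∀ j, |inner ℝ (v j) x| ≤ R ^ a j} ≤
        C * ENNReal.ofReal (R ^ ∑ j, a j * p j)) :
    p ∈ convexHull ℝ (selectionExponent '' {σ : Fin n → ι | LinearIndependent ℝ (v ∘ σ)}) := by
  by_contra hp
  obtain ⟨f, u, hfp, hfu⟩ := geometric_hahn_banach_point_closed (convex_convexHull ℝ _)
    (((Set.toFinite _).image _).isClosed_convexHull (𝕜 := ℝ)) hp
  set a : ι → ℝ := fun j => f (Pi.single j 1) with ha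
  obtain ⟨σ, hσ, hσe⟩ := exists_linearIndependent_sum_le_of_volume_le a hC (h a)
  have h1 := hfu _ (subset_convexHull ℝ _ (Set.mem_image_of_mem _ hσ))
  have h2 : f (selectionExponent σ) = ∑ i, a (σ i) := by simp [selectionExponent, ha]
  have h3 : f p = ∑ j, a j * p j := by
    conv_lhs => rw [← Finset.univ_sum_single p]
    rw [map_sum]
    refine Finset.sum_congr rfl fun j _ => ?_
    rw [ha, mul_comm, ← smul_eq_mul, ← map_smul, ← Pi.single_smul, smul_eq_mul, mul_one]
  linarith

/-- Testing a Brascamp–Lieb inequality with maps `x ↦ ⟨v j, x⟩` on indicators of the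
intervals `[-R ^ a j, R ^ a j]`. -/
lemma volume_le_of_isBrascampLiebBound {ι : Type*} [Fintype ι] {n : ℕ}
    {L : ι → EuclideanSpace ℝ (Fin n) →L[ℝ] ℝ} {v : ι → EuclideanSpace ℝ (Fin n)}
    (hL : ∀ j x, L j x = inner ℝ (v j) x) {p : ι → ℝ} (hp : ∀ j, 0 ≤ p j) {C : ℝ≥0∞}
    (hC : IsBrascampLiebBound L p C) (a : ι → ℝ) {R : ℝ} (hR : 0 < R) :
    volume {x | ∀ j, |inner ℝ (v j) x| ≤ R ^ a j} ≤
      (C * ENNReal.ofReal (2 ^ ∑ j, p j)) * ENNReal.ofReal (R ^ ∑ j, a j * p j) := by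
  set f : ι → ℝ → ℝ≥0 := fun j => (Icc (-(R ^ a j)) (R ^ a j)).indicator 1 with hf
  have hfint : ∀ j, ∫⁻ y, (f j y : ℝ≥0∞) = ENNReal.ofReal (2 * R ^ a j) := by
    intro j
    have : ∀ y, (f j y : ℝ≥0∞) = (Icc (-(R ^ a j)) (R ^ a j)).indicator 1 y := by
      intro y
      by_cases hy : y ∈ Icc (-(R ^ a j)) (R ^ a j) <;> simp [hf, hy]
    simp_rw [this]
    rw [lintegral_indicator_one measurableSet_Icc, Real.volume_Icc]
    congr 1
    ring
  have h := hC f (fun j => measurable_const.indicator measurableSet_Icc)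
    (fun j => by rw [hfint]; exact ENNReal.ofReal_ne_top)
  have hmeas : MeasurableSet {x : EuclideanSpace ℝ (Fin n) | ∀ j, |inner ℝ (v j) x| ≤ R ^ a j} := by
    rw [ofPred_forall]
    exact MeasurableSet.iInter fun j => measurableSet_le (by fun_prop) (by fun_prop)
  calc volume {x | ∀ j, |inner ℝ (v j) x| ≤ R ^ a j}
      = ∫⁻ x, ({x | ∀ j, |inner ℝ (v j) x| ≤ R ^ a j}).indicator 1 x :=
        (lintegral_indicator_one hmeas).symm
    _ ≤ ∫⁻ x, ∏ j, (f j (L j x) : ℝ≥0∞) ^ p j := by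
        refine lintegral_mono fun x => ?_
        by_cases hx : ∀ j, |inner ℝ (v j) x| ≤ R ^ a j
        · have : ∀ j, f j (L j x) = 1 := fun j => by
            have hmem : L j x ∈ Icc (-(R ^ a j)) (R ^ a j) := by rw [hL]; exact abs_le.1 (hx j)
            simp [hf, indicator_of_mem hmem]
          simp [this, hx]
        · simp [hx]
    _ ≤ C * ∏ j, (∫⁻ y, (f j y : ℝ≥0∞)) ^ p j := h
    _ = _ := by
        rw [mul_assoc, ← ENNReal.ofReal_mul (by positivity), Real.rpow_sum_of_pos two_pos,
          Real.rpow_sum_of_pos hR, ← Finset.prod_mul_distrib,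
          ENNReal.ofReal_prod_of_nonneg fun j _ => by positivity]
        congr 1
        refine Finset.prod_congr rfl fun j _ => ?_
        rw [hfint, ENNReal.ofReal_rpow_of_nonneg (by positivity) (hp j),
          Real.mul_rpow (by positivity) (by positivity), ← Real.rpow_mul hR.le]

/-! ### Interpolation between bases -/

/-- The set of nonnegative exponent vectors `q` for which the local multilinear restriction estimate
`∫ ∏ |E_j g_j|^{2 q_j} ≤ C ∏ ‖g_j‖₂^{2 q_j}` holds near the origin. -/
def restrictionExponents {ι : Type*} [Fintype ι] {E : Type*} [NormedAddCommGroup E]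
    [InnerProductSpace ℝ E] [MeasureSpace E] (V : ι → Set ℝ) (γ : ι → ℝ → E) : Set (ι → ℝ) :=
  {q | (∀ j, 0 ≤ q j) ∧ ∃ δ : ℝ, 0 < δ ∧ ∃ C : ℝ≥0, ∀ U : ι → Set ℝ,
    (∀ j, IsOpen (U j)) → (∀ j, (0 : ℝ) ∈ U j) →
    (∀ j, U j ⊆ V j) → (∀ j, U j ⊆ Metric.ball 0 δ) →
    ∀ g : ι → ℝ → ℂ, (∀ j, MemLp (g j) 2 (volume.restrict (U j))) →
      ∫⁻ ξ, ∏ j, ‖extensionOp (U j) (γ j) (g j) ξ‖ₑ ^ (2 * q j) ≤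
        C * ∏ j, (eLpNorm (g j) 2 (volume.restrict (U j))) ^ (2 * q j)}

lemma prod_rpow_convexCombination {ι : Type*} [Fintype ι] (t : ι → ℝ≥0∞) {q r : ι → ℝ}
    (hq : ∀ j, 0 ≤ q j) (hr : ∀ j, 0 ≤ r j) {a b : ℝ} (ha : 0 ≤ a) (hb : 0 ≤ b) :
    ∏ j, t j ^ (2 * (a • q + b • r) j) =
      (∏ j, t j ^ (2 * q j)) ^ a * (∏ j, t j ^ (2 * r j)) ^ b := by
  rw [← ENNReal.prod_rpow_of_nonneg ha, ← ENNReal.prod_rpow_of_nonneg hb,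
    ← Finset.prod_mul_distrib]
  refine Finset.prod_congr rfl fun j _ => ?_
  have h1 := mul_nonneg (mul_nonneg zero_le_two (hq j)) ha
  have h2 := mul_nonneg (mul_nonneg zero_le_two (hr j)) hb
  rw [← ENNReal.rpow_mul, ← ENNReal.rpow_mul, ← ENNReal.rpow_add_of_nonneg _ _ h1 h2]
  congr 1
  simp
  ring

/-- Hölder's inequality interpolates between two estimates. -/
lemma convex_restrictionExponents {ι : Type*} [Fintype ι] {E : Type*} [NormedAddCommGroup E]
    [InnerProductSpace ℝ E] [FiniteDimensional ℝ E] [MeasureSpace E] [BorelSpace E]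
    [SFinite (volume : Measure E)]
    {V : ι → Set ℝ} {γ : ι → ℝ → E} (hγ : ∀ j, ContinuousOn (γ j) (V j)) :
    Convex ℝ (restrictionExponents V γ) := by
  rintro q ⟨hq, δ, hδ, C, hC⟩ r ⟨hr, δ', hδ', C', hC'⟩ a b ha hb hab
  refine ⟨fun j => by simpa using by have := hq j; have := hr j; positivity, min δ δ',
    lt_min hδ hδ', C ^ a * C' ^ b, fun U hU h0 hUV hUδ g hg => ?_⟩
  have hm : ∀ j, AEMeasurable (fun ξ : E => ‖extensionOp (U j) (γ j) (g j) ξ‖ₑ) := by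
    intro j
    have hfin : IsFiniteMeasure (volume.restrict (U j)) :=
      isFiniteMeasure_restrict.2 ((measure_mono (hUδ j)).trans_lt measure_ball_lt_top).ne
    exact (aestronglyMeasurable_fourierChar_smul (ν := (volume : Measure E))
      (((hγ j).mono (hUV j)).aemeasurable (hU j).measurableSet) (hg j).1).integral_prod_right'.enorm
  have hmq : ∀ s : ι → ℝ, AEMeasurable (fun ξ : E =>
      ∏ j, ‖extensionOp (U j) (γ j) (g j) ξ‖ₑ ^ (2 * s j)) := fun s =>
    Finset.aemeasurable_fun_prod _ fun j _ => (hm j).pow_const _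
  simp_rw [prod_rpow_convexCombination _ hq hr ha hb]
  refine (ENNReal.lintegral_mul_norm_pow_le (hmq q) (hmq r) ha hb hab).trans ?_
  have h1 := hC U hU h0 hUV (fun j => (hUδ j).trans (Metric.ball_subset_ball (min_le_left _ _))) g hg
  have h2 := hC' U hU h0 hUV (fun j => (hUδ j).trans (Metric.ball_subset_ball (min_le_right _ _)))
    g hg
  calc _ ≤ (C * ∏ j, (eLpNorm (g j) 2 (volume.restrict (U j))) ^ (2 * q j)) ^ a *
        (C' * ∏ j, (eLpNorm (g j) 2 (volume.restrict (U j))) ^ (2 * r j)) ^ b := by gcongr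
    _ = _ := by
      rw [ENNReal.mul_rpow_of_nonneg _ _ ha, ENNReal.mul_rpow_of_nonneg _ _ hb,
        ENNReal.coe_mul, ENNReal.coe_rpow_of_nonneg _ ha, ENNReal.coe_rpow_of_nonneg _ hb]
      ring

lemma prod_rpow_selectionExponent {ι : Type*} [Fintype ι] [DecidableEq ι] {n : ℕ} (σ : Fin n → ι)
    (t : ι → ℝ≥0∞) : ∏ j, t j ^ (2 * selectionExponent σ j) = ∏ i, t (σ i) ^ 2 := by
  have h : ∀ j, t j ^ (2 * selectionExponent σ j) = ∏ i, if σ i = j then t j ^ 2 else 1 := by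
    intro j
    have : selectionExponent σ j = ((Finset.univ.filter fun i => σ i = j).card : ℝ) := by
      simp [selectionExponent, Pi.single_apply, eq_comm]
    rw [this, Finset.prod_ite, Finset.prod_const, Finset.prod_const_one, mul_one, ← pow_mul,
      ← ENNReal.rpow_natCast]
    push_cast
    rfl
  simp_rw [h]
  rw [Finset.prod_comm]
  simp

/-- At the vertices of the base polytope only the curves of a basis occur, each to the power `2`. -/
lemma selectionExponent_mem_restrictionExponents {ι : Type*} [Fintype ι] [DecidableEq ι] {n : ℕ}
    {V : ι → Set ℝ} {γ : ι → ℝ → EuclideanSpace ℝ (Fin n)} (hγ : ∀ j, ContinuousOn (γ j) (V j))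
    {v : ι → EuclideanSpace ℝ (Fin n)} (hv : ∀ j, HasStrictDerivAt (γ j) (v j) 0)
    {σ : Fin n → ι} (hσ : LinearIndependent ℝ (v ∘ σ)) :
    selectionExponent σ ∈ restrictionExponents V γ := by
  obtain ⟨δ, hδ, C, hC⟩ := lintegral_prod_enorm_extensionOp_sq_le (fun i => hv (σ i)) hσ
  refine ⟨fun j => ?_, δ, hδ, C, fun U hU _ hUV hUδ g hg => ?_⟩
  · simp only [selectionExponent, Finset.sum_apply]
    exact Finset.sum_nonneg fun i _ => by
      rw [Pi.single_apply]; split_ifs <;> simp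
  · simp_rw [prod_rpow_selectionExponent]
    exact hC (fun i => U (σ i)) (fun i => (hU _).measurableSet)
      (fun i => (hγ _).mono (hUV _)) (fun i => hUδ _) (fun i => g (σ i)) (fun i => hg _)

theorem mainTheorem2 (n m : ℕ) (V : Fin m → Set ℝ) (γ : Fin m → ℝ → EuclideanSpace ℝ (Fin n))
    (hγ : ∀ j, IsSmoothParametrisation (V j) (γ j))
    (p : Fin m → ℝ) (hp : ∀ j, 0 ≤ p j)
    (hBL : brascampLiebConst (fun j => ContinuousLinearMap.adjoint (fderiv ℝ (γ j) 0)) p < ⊤) :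
    ∃ δ : ℝ, 0 < δ ∧ ∃ C : ℝ≥0, ∀ U : Fin m → Set ℝ,
      (∀ j, IsOpen (U j)) → (∀ j, (0 : ℝ) ∈ U j) →
      (∀ j, U j ⊆ V j) → (∀ j, U j ⊆ Metric.ball 0 δ) →
      ∀ g : Fin m → ℝ → ℂ, (∀ j, MemLp (g j) 2 (volume.restrict (U j))) →
        ∫⁻ ξ, ∏ j, ‖extensionOp (U j) (γ j) (g j) ξ‖ₑ ^ (2 * p j) ≤
          C * ∏ j, (eLpNorm (g j) 2 (volume.restrict (U j))) ^ (2 * p j) := by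
  classical
  set v : Fin m → EuclideanSpace ℝ (Fin n) := fun j => fderiv ℝ (γ j) 0 1 with hv
  have hcont : ∀ j, ContinuousOn (γ j) (V j) := fun j => (hγ j).contDiffOn.continuousOn
  have hderiv : ∀ j, HasStrictDerivAt (γ j) (v j) 0 := fun j =>
    (((hγ j).contDiffOn.contDiffAt ((hγ j).isOpen.mem_nhds (hγ j).zero_mem)).hasStrictFDerivAt
      (by simp)).hasStrictDerivAt
  -- The adjoint of `t ↦ t • v j` is `x ↦ ⟨v j, x⟩`.
  have hL : ∀ j x, ContinuousLinearMap.adjoint (fderiv ℝ (γ j) 0) x = inner ℝ (v j) x := by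
    intro j x
    have h := ContinuousLinearMap.adjoint_inner_right (fderiv ℝ (γ j) 0) (1 : ℝ) x
    simpa [hv] using h
  obtain ⟨C, hC, hCtop⟩ := sInf_lt_iff.1 hBL
  have hp' : p ∈ convexHull ℝ
      (selectionExponent '' {σ : Fin n → Fin m | LinearIndependent ℝ (v ∘ σ)}) :=
    mem_convexHull_selectionExponent (ENNReal.mul_ne_top hCtop.ne ENNReal.ofReal_ne_top)
      fun a R hR => volume_le_of_isBrascampLiebBound hL hp hC a (by linarith)
  -- Bases give estimates, and the set of admissible exponents is convex.
  have hsub : selectionExponent '' {σ : Fin n → Fin m | LinearIndependent ℝ (v ∘ σ)} ⊆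
      restrictionExponents V γ := by
    rintro _ ⟨σ, hσ, rfl⟩
    exact selectionExponent_mem_restrictionExponents hcont hderiv hσ
  exact (convexHull_min hsub (convex_restrictionExponents hcont) hp').2
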